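/- A treeshelf of size $n\ge 0$ is a binary tree with $n$ nodes in which every child is linked to its parent as a left or as a right child (at most one of each), whose nodes are labeled by $1,\dots,n$, each label being used exactly once, so that the labels strictly increase along every branch from the root; the empty tree is the treeshelf of size $0$. An occurrence of a treeshelf $P$ in a treeshelf $T$ is a placement of the nodes of $P$ on nodes of $T$ that takes left links to left links and right links to right links and preserves the relative order of the labels; $T$ avoids $P$ if there is no occurrence of $P$ in $T$. Let $P$ be the treeshelf of size three whose root $1$ has only a left child $2$, which in turn has only a right child $3$ (so that $T$ avoids $P$ exactly when no left child of $T$ has a right child), and let $pc_n$ be the total number of left children in all the treeshelves of size $n$ that avoid $P$ (the popularity of left children). Then $$\sum_{n\ge 0} pc_n\,\frac{z^n}{n!}=\left(z e^{z}-e^{z}+1\right)e^{e^{z}-1}$$ as formal power series. Moreover, for all $n\ge 0$, $$pc_n=(n+1)\,b_n-b_{n+1},$$ where $b_n$ is the $n$-th Bell number. Finally, as $n\to\infty$, $$pc_n\sim\sqrt{n}\left(\frac{n}{W(n)}\right)^{n+\frac12}e^{\frac{n}{W(n)}-n-1},$$ where $W$ is the Lambert function, that is, $W(n)$ is the unique real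 solution $w$ of $w\,e^{w}=n$. -/

import Mathlib

/-!
Treeshelves are binary increasing trees in which every child is attached to its parent either by
a left link or by a right link.  They are represented by Mathlib's `BinaryTree ℕ`, whose
constructors are `nil` (the empty tree) and `node a l r` (a root labeled `a` with left subtree `l`
and right subtree `r`, each possibly empty).
-/

namespace Treeshelf

/-- The multiset of the labels of the nodes of a tree. -/
def labels : BinaryTree ℕ → Multiset ℕ
  | .nil => 0
  | .node a l r => a ::ₘ (labels l + labels r)

/-- The labels strictly increase along all branches: at every node, the label is smaller than all
the labels below it. -/
def IsIncreasing : BinaryTree ℕ → Prop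
  | .nil => True
  | .node a l r =>
      (∀ b ∈ labels l, a < b) ∧ (∀ b ∈ labels r, a < b) ∧ IsIncreasing l ∧ IsIncreasing r

/-- `T` is a treeshelf of size `n`: its nodes are labeled by `1, …, n`, each used exactly once,
increasingly along the branches. -/
def IsTreeshelf (n : ℕ) (T : BinaryTree ℕ) : Prop :=
  labels T = (Finset.Icc 1 n).val ∧ IsIncreasing T

/-- The number of left children of a tree, that is, of nodes that are the left child of their
parent. -/
def leftChildren : BinaryTree ℕ → ℕ
  | .nil => 0
  | .node _ l r => (if l = .nil then 0 else 1) + leftChildren l + leftChildren r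

/-- Positions in a tree are lists of directions read from the root, `false` for left and `true`
for right.  `labelAt T p` is the label of the node of `T` at position `p`, if there is one. -/
def labelAt : BinaryTree ℕ → List Bool → Option ℕ
  | .nil, _ => none
  | .node a _ _, [] => some a
  | .node _ l _, false :: p => labelAt l p
  | .node _ _ r, true :: p => labelAt r p

/-- The treeshelf `P` occurs in `T` at position `v`: placing the root of `P` at position `v`, every
node of `P` falls on a node of `T` (so that left and right links of `P` fall on left and right
links of `T`), and the nodes hit are labeled in the same relative order as in `P`. -/
def OccursAt (P T : BinaryTree ℕ) (v : List Bool) : Prop :=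
  ∀ (p q : List Bool) (a b : ℕ), labelAt P p = some a → labelAt P q = some b →
    ∃ c d : ℕ, labelAt T (v ++ p) = some c ∧ labelAt T (v ++ q) = some d ∧ (a < b ↔ c < d)

/-- `T` avoids the pattern `P`: there is no occurrence of `P` in `T`. -/
def Avoids (P T : BinaryTree ℕ) : Prop :=
  ∀ v : List Bool, ¬ OccursAt P T v

/-- The pattern of size three whose root `1` has only a left child `2`, which has only a right
child `3`. -/
def leftRight : BinaryTree ℕ :=
  .node 1 (.node 2 .nil (.node 3 .nil .nil)) .nil

/-- The set of treeshelves of size `n` that avoid `P`. -/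
def avoiders (P : BinaryTree ℕ) (n : ℕ) : Set (BinaryTree ℕ) :=
  {T | IsTreeshelf n T ∧ Avoids P T}

theorem card_labels (T : BinaryTree ℕ) : (labels T).card = T.numNodes := by
  induction T with
  | nil => rfl
  | node a l r hl hr => simp [labels, hl, hr]

theorem finite_bounded (n h : ℕ) :
    {T : BinaryTree ℕ | T.height ≤ h ∧ ∀ a ∈ labels T, a ≤ n}.Finite := by
  induction h with
  | zero =>
    refine (Set.finite_singleton BinaryTree.nil).subset ?_
    rintro (_ | ⟨a, l, r⟩) ⟨h1, h2⟩
    · rfl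
    · simp at h1
  | succ h ih =>
    refine ((Set.finite_singleton BinaryTree.nil).union
      (((Set.finite_Iic n).prod (ih.prod ih)).image
        fun x => BinaryTree.node x.1 x.2.1 x.2.2)).subset ?_
    rintro (_ | ⟨a, l, r⟩) ⟨h1, h2⟩
    · exact Or.inl rfl
    · simp only [BinaryTree.height, add_le_add_iff_right, max_le_iff] at h1
      refine Or.inr ⟨(a, l, r), ⟨h2 a (by simp [labels]), ⟨h1.1, fun b hb => h2 b ?_⟩,
        ⟨h1.2, fun b hb => h2 b ?_⟩⟩, rfl⟩
      · simp [labels, hb]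
      · simp [labels, hb]

theorem finite_avoiders (P : BinaryTree ℕ) (n : ℕ) : (avoiders P n).Finite := by
  refine (finite_bounded n n).subset ?_
  rintro T ⟨⟨h1, -⟩, -⟩
  refine ⟨T.height_le_numNodes.trans ?_, fun a ha => ?_⟩
  · rw [← card_labels, h1]
    simp
  · rw [h1] at ha
    exact (Finset.mem_Icc.mp ha).2

/-- The popularity of left children: the total number of left children in all the treeshelves of
size `n` that avoid `P`. -/
noncomputable def popularity (P : BinaryTree ℕ) (n : ℕ) : ℕ :=
  ∑ T ∈ (finite_avoiders P n).toFinset, leftChildren T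

end Treeshelf

/-! In an avoiding treeshelf no left child has a right child, so it is a comb: a right spine with an
increasing left path below each spine node. A spine node and its left path form a block, so these
combs encode set partitions of the labels; they are counted by Bell numbers, and left children
number `n` minus the blocks. Removing the minimal root turns this into a recursion over subsets
(`card_combs`, `sum_leftChildren_combs`).

For `B = exp (exp z - 1)`, the equation `B' = exp z * B` encodes the Bell recurrence, and the
claimed series is `(z B)' - B'`.

The asymptotics come from the saddle-point method: in Cauchy's formula on the circle of radius `r =
W n`, the relation `r * exp r = n` cancels the linear phase at `θ = 0`. On the scale `t =
saddleScale r * θ` the kernel tends to `exp (-t² / 2)`, with an integrable majorant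
(`norm_saddleKernel_div_le`); dominated convergence and Stirling's formula conclude. -/

namespace Treeshelf

/-! ### Avoidance as a condition on the shape -/

/-- The left path whose labels, read from the root, are the entries of a list. -/
def leftPath : List ℕ → BinaryTree ℕ
  | [] => .nil
  | a :: s => .node a (leftPath s) .nil

/-- No node of the tree has a right child. -/
def IsLeftPath : BinaryTree ℕ → Prop
  | .nil => True
  | .node _ l r => IsLeftPath l ∧ r = .nil

/-- Every left subtree hanging off the rightmost branch is a left path. -/
def IsComb : BinaryTree ℕ → Prop
  | .nil => True
  | .node _ l r => IsLeftPath l ∧ IsComb r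

theorem not_occursAt_nil (v : List Bool) : ¬ OccursAt leftRight .nil v := by
  intro h
  obtain ⟨c, d, h1, -⟩ := h [] [] 1 1 rfl rfl
  simp [labelAt] at h1

theorem avoids_nil : Avoids leftRight .nil := not_occursAt_nil

theorem avoids_node_iff (a : ℕ) (l r : BinaryTree ℕ) :
    Avoids leftRight (.node a l r) ↔
      ¬ OccursAt leftRight (.node a l r) [] ∧ Avoids leftRight l ∧ Avoids leftRight r := by
  constructor
  · intro h
    exact ⟨h [], fun v => h (false :: v), fun v => h (true :: v)⟩
  · rintro ⟨h1, h2, h3⟩ (_ | ⟨_ | _, v⟩)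
    · exact h1
    · exact h2 v
    · exact h3 v

theorem labelAt_leftRight {p : List Bool} {a : ℕ} (h : labelAt leftRight p = some a) :
    p = [] ∧ a = 1 ∨ p = [false] ∧ a = 2 ∨ p = [false, true] ∧ a = 3 := by
  rcases p with _ | ⟨_ | _, _ | ⟨_ | _, _ | ⟨_ | _, p⟩⟩⟩ <;>
    simp_all [leftRight, labelAt]

/-- Increasing labels make the order condition automatic along a branch, so only the existence of
the three positions matters. -/
theorem occursAt_root_iff {a b : ℕ} {l' r' r : BinaryTree ℕ}
    (h : IsIncreasing (.node a (.node b l' r') r)) :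
    OccursAt leftRight (.node a (.node b l' r') r) [] ↔ r' ≠ .nil := by
  constructor
  · rintro h1 rfl
    obtain ⟨c, d, h2, -⟩ := h1 [false, true] [] 3 1 rfl rfl
    simp [labelAt] at h2
  · intro h1
    obtain _ | ⟨c, x, y⟩ := r'
    · exact absurd rfl h1
    have hab : a < b := h.1 b (by simp [labels])
    have hbc : b < c := h.2.2.1.2.1 c (by simp [labels])
    intro p q i j hp hq
    rcases labelAt_leftRight hp with ⟨rfl, rfl⟩ | ⟨rfl, rfl⟩ | ⟨rfl, rfl⟩ <;>
    rcases labelAt_leftRight hq with ⟨rfl, rfl⟩ | ⟨rfl, rfl⟩ | ⟨rfl, rfl⟩ <;>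
    simp [labelAt] <;> omega

theorem not_occursAt_root (a : ℕ) (r : BinaryTree ℕ) :
    ¬ OccursAt leftRight (.node a .nil r) [] := by
  intro h
  obtain ⟨c, d, h2, -⟩ := h [false] [] 2 1 rfl rfl
  simp [labelAt] at h2

/-- Avoidance at the root strips the left child of its right subtree; the argument then repeats with
the left child as the new root, hence the generalization over `a` and `r`. -/
theorem avoids_left_iff (a : ℕ) (l r : BinaryTree ℕ) (h : IsIncreasing (.node a l r)) :
    ¬ OccursAt leftRight (.node a l r) [] ∧ Avoids leftRight l ↔ IsLeftPath l := by
  induction l generalizing a r with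
  | nil => simp [IsLeftPath, avoids_nil, not_occursAt_root]
  | node b l' r' ih _ =>
    rw [occursAt_root_iff h, avoids_node_iff, not_not]
    have := ih b r' h.2.2.1
    simp only [IsLeftPath, ← this]
    constructor
    · rintro ⟨rfl, h1, h2, -⟩
      exact ⟨⟨h1, h2⟩, rfl⟩
    · rintro ⟨⟨h1, h2⟩, rfl⟩
      exact ⟨rfl, h1, h2, avoids_nil⟩

theorem avoids_iff_isComb {T : BinaryTree ℕ} (h : IsIncreasing T) :
    Avoids leftRight T ↔ IsComb T := by
  induction T with
  | nil => simp [IsComb, avoids_nil]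
  | node a l r _ ih =>
    rw [avoids_node_iff, ← and_assoc, avoids_left_iff a l r h, ih h.2.2.2, IsComb]

/-! ### Decomposition of increasing combs at the root -/

theorem labels_eq_zero {T : BinaryTree ℕ} : labels T = 0 ↔ T = .nil := by
  cases T <;> simp [labels]

/-- The label of the root is the least one. -/
theorem root_eq_of_labels_eq {a b : ℕ} {l r : BinaryTree ℕ} {s : Multiset ℕ}
    (h : IsIncreasing (.node b l r)) (hs : ∀ x ∈ s, a < x)
    (hl : labels (.node b l r) = a ::ₘ s) : b = a ∧ labels l + labels r = s := by
  have hb : b ∈ a ::ₘ s := by rw [← hl]; simp [labels]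
  have ha : a ∈ labels (.node b l r) := by rw [hl]; simp
  have : b = a := by
    rcases Multiset.mem_cons.1 hb with hb | hb
    · exact hb
    · simp only [labels, Multiset.mem_cons, Multiset.mem_add] at ha
      have h1 := hs b hb
      rcases ha with ha | ha | ha
      · exact ha.symm
      · exact absurd (h.1 a ha) (by omega)
      · exact absurd (h.2.1 a ha) (by omega)
  subst this
  exact ⟨rfl, by simpa [labels] using hl⟩

theorem labels_leftPath (s : List ℕ) : labels (leftPath s) = s := by
  induction s with
  | nil => rfl
  | cons a s ih => simp [leftPath, labels, ih]

theorem isLeftPath_leftPath (s : List ℕ) : IsLeftPath (leftPath s) := by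
  induction s with
  | nil => trivial
  | cons a s ih => exact ⟨ih, rfl⟩

theorem isIncreasing_leftPath {s : List ℕ} (h : s.Pairwise (· < ·)) :
    IsIncreasing (leftPath s) := by
  induction s with
  | nil => trivial
  | cons a s ih =>
    rw [List.pairwise_cons] at h
    exact ⟨by simpa [labels_leftPath] using h.1, by simp [labels], ih h.2, trivial⟩

theorem eq_leftPath {T : BinaryTree ℕ} {s : List ℕ} (hs : s.Pairwise (· < ·))
    (h : IsIncreasing T) (hT : IsLeftPath T) (hl : labels T = s) : T = leftPath s := by
  induction s generalizing T with
  | nil => exact labels_eq_zero.1 hl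
  | cons a s ih =>
    obtain _ | ⟨b, l, r⟩ := T
    · exact absurd hl.symm (by simp [labels])
    · rw [List.pairwise_cons] at hs
      obtain ⟨rfl, h2⟩ := root_eq_of_labels_eq h (s := s) (by simpa using hs.1) hl
      obtain ⟨h3, rfl⟩ := hT
      rw [ih hs.2 h.2.2.1 h3 (by simpa [labels] using h2), leftPath]

theorem leftChildren_node_leftPath (a : ℕ) (s : List ℕ) (r : BinaryTree ℕ) :
    leftChildren (.node a (leftPath s) r) = s.length + leftChildren r := by
  induction s generalizing a r with
  | nil => simp [leftPath, leftChildren]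
  | cons b s ih =>
    have := ih b .nil
    rw [leftPath, leftChildren, this]
    simp [leftChildren]
    omega

/-- The increasing combs with a given set of labels. -/
def combs (S : Finset ℕ) : Set (BinaryTree ℕ) :=
  {T | labels T = S.val ∧ IsIncreasing T ∧ IsComb T}

theorem finite_combs (S : Finset ℕ) : (combs S).Finite := by
  refine (finite_bounded (S.sup id) S.card).subset ?_
  rintro T ⟨h1, -⟩
  refine ⟨T.height_le_numNodes.trans ?_, fun a ha => ?_⟩
  · rw [← card_labels, h1]
    simp
  · rw [h1] at ha
    exact Finset.le_sup (f := id) ha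

theorem combs_empty : combs ∅ = {.nil} := by
  ext T
  simp only [combs, Finset.empty_val, labels_eq_zero, Set.mem_ofPred_eq, Set.mem_singleton_iff]
  constructor
  · exact fun h => h.1
  · rintro rfl
    exact ⟨rfl, trivial, trivial⟩

/-- The minimum must be the root, and an increasing left path is determined by its label set; the
only freedom is the set `A` and the comb on the remaining labels. -/
theorem mem_combs_insert {a : ℕ} {S : Finset ℕ} (ha : ∀ x ∈ S, a < x) (T : BinaryTree ℕ) :
    T ∈ combs (insert a S) ↔
      ∃ A ⊆ S, ∃ r ∈ combs (S \ A), T = .node a (leftPath (A.sort)) r := by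
  have haS : a ∉ S := fun h => (ha a h).false
  constructor
  · rintro ⟨h1, h2, h3⟩
    rw [Finset.insert_val_of_notMem haS] at h1
    obtain _ | ⟨b, l, r⟩ := T
    · simp [labels] at h1
    obtain ⟨rfl, h4⟩ := root_eq_of_labels_eq h2 (by simpa using ha) h1
    have hle : labels l ≤ S.val := h4 ▸ Multiset.le_add_right _ _
    let A : Finset ℕ := ⟨labels l, Multiset.nodup_of_le hle S.nodup⟩
    have hA : A ⊆ S := Finset.val_le_iff.1 hle
    refine ⟨A, hA, r, ⟨?_, h2.2.2.2, h3.2⟩, ?_⟩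
    · rw [Finset.sdiff_val, ← h4]
      simp [A]
    · rw [eq_leftPath (s := A.sort) (Finset.sortedLT_sort A).pairwise h2.2.2.1 h3.1
        (by simp [A])]
  · rintro ⟨A, hA, r, ⟨h1, h2, h3⟩, rfl⟩
    have hl : labels (leftPath A.sort) = A.val := by simp [labels_leftPath]
    refine ⟨?_, ⟨?_, ?_, isIncreasing_leftPath (Finset.sortedLT_sort A).pairwise, h2⟩,
      isLeftPath_leftPath _, h3⟩
    · rw [labels, hl, h1, Finset.insert_val_of_notMem haS, Finset.sdiff_val,
        add_tsub_cancel_of_le (Finset.val_le_iff.2 hA)]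
    · rw [hl]
      exact fun b hb => ha b (hA hb)
    · rw [h1]
      exact fun b hb => ha b (Finset.sdiff_subset hb)

theorem sum_combs_insert {M : Type*} [AddCommMonoid M] {a : ℕ} {S : Finset ℕ}
    (ha : ∀ x ∈ S, a < x) (f : BinaryTree ℕ → M) :
    ∑ T ∈ (finite_combs (insert a S)).toFinset, f T =
      ∑ A ∈ S.powerset, ∑ r ∈ (finite_combs (S \ A)).toFinset,
        f (.node a (leftPath A.sort) r) := by
  rw [Finset.sum_sigma']
  symm
  refine Finset.sum_bij (fun x _ => .node a (leftPath x.1.sort) x.2) ?_ ?_ ?_ ?_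
  · rintro ⟨A, r⟩ h
    simp only [Finset.mem_sigma, Finset.mem_powerset, Set.Finite.mem_toFinset] at h ⊢
    exact (mem_combs_insert ha _).2 ⟨A, h.1, r, h.2, rfl⟩
  · rintro ⟨A, r⟩ - ⟨B, r'⟩ - h
    simp only [BinaryTree.node.injEq, true_and] at h
    obtain ⟨h, rfl⟩ := h
    have := congrArg labels h
    simp only [labels_leftPath, Finset.sort_eq] at this
    rw [Finset.val_inj.1 this]
  · intro T hT
    obtain ⟨A, hA, r, hr, rfl⟩ := (mem_combs_insert ha T).1 (by simpa using hT)
    exact ⟨⟨A, r⟩, by simp [hA, hr], rfl⟩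
  · intros
    rfl

/-! ### Bell recurrences and enumeration of combs -/

theorem sum_choose_mul_bell (n : ℕ) :
    ∑ i ∈ Finset.range (n + 1), n.choose i * Nat.bell (n - i) = Nat.bell (n + 1) := by
  rw [Nat.bell_succ, Nat.range_succ_eq_Iic]

theorem sum_choose_mul_bell' (n : ℕ) :
    ∑ i ∈ Finset.range (n + 1), n.choose i * Nat.bell i = Nat.bell (n + 1) := by
  rw [← sum_choose_mul_bell, ← Finset.sum_range_reflect]
  refine Finset.sum_congr rfl fun i hi => ?_
  have : i ≤ n := Nat.lt_succ_iff.1 (Finset.mem_range.1 hi)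
  rw [Nat.add_sub_cancel, Nat.choose_symm this]

/-- Pascal's rule splits `∑ (n+1).choose i * bell i = bell (n+2)` into the reflected form of the sum
here and `∑ n.choose i * bell i = bell (n+1)`. -/
theorem sum_choose_mul_bell_succ (n : ℕ) :
    (∑ i ∈ Finset.range (n + 1), n.choose i * Nat.bell (n - i + 1)) + Nat.bell (n + 1) =
      Nat.bell (n + 2) := by
  have h : ∑ i ∈ Finset.range (n + 1), n.choose i * Nat.bell (n - i + 1) =
      ∑ i ∈ Finset.range (n + 1), n.choose i * Nat.bell (i + 1) := by
    rw [← Finset.sum_range_reflect]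
    refine Finset.sum_congr rfl fun i hi => ?_
    have : i ≤ n := Nat.lt_succ_iff.1 (Finset.mem_range.1 hi)
    rw [Nat.add_sub_cancel, Nat.choose_symm this, Nat.sub_sub_self this]
  have h' := Finset.sum_range_succ' (fun i => n.choose i * Nat.bell i) (n + 1)
  rw [Finset.sum_range_succ, sum_choose_mul_bell', Nat.choose_succ_self] at h'
  rw [h, ← sum_choose_mul_bell' (n + 1), Finset.sum_range_succ' _ (n + 1)]
  simp only [Nat.choose_succ_succ', add_mul, Finset.sum_add_distrib]
  simp at h' ⊢
  omega

theorem card_combs (S : Finset ℕ) : (finite_combs S).toFinset.card = Nat.bell S.card := by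
  induction h : S.card using Nat.strong_induction_on generalizing S with
  | _ n ih =>
  rcases S.eq_empty_or_nonempty with rfl | hS
  · subst h
    simp [combs_empty]
  · obtain ⟨a, S, ha, rfl⟩ : ∃ a S', (∀ x ∈ S', a < x) ∧ S = insert a S' :=
      ⟨S.min' hS, S.erase (S.min' hS), fun x hx => Finset.min'_lt_of_mem_erase_min' _ hS hx,
        (Finset.insert_erase (S.min'_mem hS)).symm⟩
    have haS : a ∉ S := fun h => (ha a h).false
    rw [Finset.card_insert_of_notMem haS] at h
    subst h
    rw [Finset.card_eq_sum_ones, sum_combs_insert ha, ← sum_choose_mul_bell]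
    have : ∀ A ∈ S.powerset, ∑ r ∈ (finite_combs (S \ A)).toFinset, 1 =
        Nat.bell (S.card - A.card) := by
      intro A hA
      rw [Finset.mem_powerset] at hA
      have hc := Finset.card_sdiff_of_subset hA
      rw [← Finset.card_eq_sum_ones, ih _ (by omega) _ hc]
    rw [Finset.sum_congr rfl this,
      Finset.sum_powerset_apply_card (fun i => Nat.bell (S.card - i))]
    simp

/-- With `m = S.card - A.card` (`S` without its minimum), a left path on `A` adds `A.card * bell m`
to the inductive value `(m + 1) * bell m - bell (m + 1)`. The coefficient of `bell m` becomes
`S.card + 1`, independent of `A`, so the Bell recurrences sum everything. -/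
theorem sum_leftChildren_combs (S : Finset ℕ) :
    ((∑ T ∈ (finite_combs S).toFinset, leftChildren T : ℕ) : ℤ) =
      (S.card + 1) * Nat.bell S.card - Nat.bell (S.card + 1) := by
  induction h : S.card using Nat.strong_induction_on generalizing S with
  | _ n ih =>
  rcases S.eq_empty_or_nonempty with rfl | hS
  · subst h
    simp [combs_empty, leftChildren]
  · obtain ⟨a, S, ha, rfl⟩ : ∃ a S', (∀ x ∈ S', a < x) ∧ S = insert a S' :=
      ⟨S.min' hS, S.erase (S.min' hS), fun x hx => Finset.min'_lt_of_mem_erase_min' _ hS hx,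
        (Finset.insert_erase (S.min'_mem hS)).symm⟩
    have haS : a ∉ S := fun h => (ha a h).false
    rw [Finset.card_insert_of_notMem haS] at h
    subst h
    rw [sum_combs_insert ha]
    have key : ∀ A ∈ S.powerset, ((∑ r ∈ (finite_combs (S \ A)).toFinset,
        leftChildren (.node a (leftPath A.sort) r) : ℕ) : ℤ) =
        (S.card + 1) * Nat.bell (S.card - A.card) - Nat.bell (S.card - A.card + 1) := by
      intro A hA
      rw [Finset.mem_powerset] at hA
      have hc := Finset.card_sdiff_of_subset hA
      have hle := Finset.card_le_card hA
      simp only [leftChildren_node_leftPath, Finset.sum_add_distrib, Finset.sum_const,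
        Finset.length_sort, smul_eq_mul]
      rw [Nat.cast_add, ih _ (by omega) _ hc, card_combs, hc]
      push_cast [hle]
      ring
    rw [Nat.cast_sum, Finset.sum_congr rfl key, Finset.sum_powerset_apply_card
      (fun i => ((S.card : ℤ) + 1) * Nat.bell (S.card - i) - Nat.bell (S.card - i + 1))]
    have h1 := sum_choose_mul_bell S.card
    have h2 := sum_choose_mul_bell_succ S.card
    zify at h1 h2
    rw [← h2, ← h1]
    simp only [smul_sub, Finset.sum_sub_distrib, nsmul_eq_mul, mul_left_comm _ ((S.card : ℤ) + 1),
      ← Finset.mul_sum]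
    push_cast
    ring

theorem avoiders_leftRight (n : ℕ) : avoiders leftRight n = combs (Finset.Icc 1 n) := by
  ext T
  simp only [avoiders, IsTreeshelf, combs, Set.mem_ofPred_eq, and_assoc]
  exact and_congr_right fun _ => and_congr_right fun h => avoids_iff_isComb h

theorem popularity_leftRight (n : ℕ) :
    (popularity leftRight n : ℤ) = ((n : ℤ) + 1) * Nat.bell n - Nat.bell (n + 1) := by
  have := sum_leftChildren_combs (Finset.Icc 1 n)
  simp only [Nat.card_Icc, Nat.add_sub_cancel] at this
  rw [← this, popularity]
  congr 2
  ext T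
  simp [avoiders_leftRight]

end Treeshelf

/-! ### The formal exponential generating functions -/

open PowerSeries in
theorem PowerSeries.coeff_exp_subst_exp_sub_one (n : ℕ) :
    coeff n (subst (exp ℚ - 1 : ℚ⟦X⟧) (exp ℚ)) = (Nat.bell n : ℚ) / n.factorial := by
  have hs : HasSubst (exp ℚ - 1 : ℚ⟦X⟧) := HasSubst.of_constantCoeff_zero' (by simp)
  have hd : d⁄dX ℚ (subst (exp ℚ - 1 : ℚ⟦X⟧) (exp ℚ)) =
      exp ℚ * subst (exp ℚ - 1 : ℚ⟦X⟧) (exp ℚ) := by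
    rw [derivative_subst hs, derivative_exp, map_sub, derivative_exp]
    simp [mul_comm]
  induction n using Nat.strong_induction_on with
  | _ n ih =>
  obtain _ | n := n
  · have : constantCoeff (subst (exp ℚ - 1 : ℚ⟦X⟧) (exp ℚ)) = 1 := by
      rw [← coeff_zero_eq_constantCoeff_apply, coeff_subst' hs, finsum_eq_single _ 0]
      · simp
      · intro n hn
        simp [hn]
    simp [this]
  · have h := congrArg (coeff n) hd
    rw [coeff_derivative, coeff_mul] at h
    have h1 : (n : ℚ) + 1 ≠ 0 := by positivity
    rw [← mul_left_inj' h1, h, Nat.bell_succ', Nat.factorial_succ]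
    push_cast
    rw [div_mul_eq_mul_div, mul_comm (_ + 1 : ℚ) (n.factorial : ℚ), mul_div_mul_right _ _ h1,
      Finset.sum_div]
    refine Finset.sum_congr rfl fun ij hij => ?_
    have hij' := Finset.HasAntidiagonal.mem_antidiagonal.1 hij
    rw [ih ij.2 (by omega), coeff_exp, ← hij', Nat.cast_add_choose]
    have := Nat.cast_ne_zero (R := ℚ).2 (Nat.factorial_ne_zero (ij.1 + ij.2))
    simp
    field_simp

open PowerSeries in
theorem Treeshelf.mk_popularity_leftRight :
    mk (fun n : ℕ => (popularity leftRight n : ℚ) / (n.factorial : ℚ)) =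
      (X * exp ℚ - exp ℚ + 1) * subst (exp ℚ - 1 : ℚ⟦X⟧) (exp ℚ) := by
  set B : ℚ⟦X⟧ := subst (exp ℚ - 1 : ℚ⟦X⟧) (exp ℚ) with hB
  have hs : HasSubst (exp ℚ - 1 : ℚ⟦X⟧) := HasSubst.of_constantCoeff_zero' (by simp)
  have hd : d⁄dX ℚ B = exp ℚ * B := by
    rw [hB, derivative_subst hs, derivative_exp, map_sub, derivative_exp]
    simp [mul_comm]
  -- As a difference of derivatives, its coefficients are shifted coefficients of `B`, and no
  -- convolution is needed.
  have h : (X * exp ℚ - exp ℚ + 1) * B = d⁄dX ℚ (X * B) - d⁄dX ℚ B := by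
    rw [Derivation.leibniz, hd, derivative_X]
    simp only [smul_eq_mul]
    ring
  ext n
  have hp : (popularity leftRight n : ℚ) = ((n : ℚ) + 1) * Nat.bell n - Nat.bell (n + 1) := by
    exact_mod_cast popularity_leftRight n
  rw [h, map_sub, coeff_derivative, coeff_derivative, coeff_succ_X_mul, coeff_mk, hp,
    coeff_exp_subst_exp_sub_one, coeff_exp_subst_exp_sub_one, Nat.factorial_succ]
  push_cast
  field_simp

/-! ### The entire generating functions and Cauchy's formula -/

/-- The exponential generating function of the Bell numbers. -/
noncomputable def bellGF (z : ℂ) : ℂ := Complex.exp (Complex.exp z - 1)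

theorem contDiff_bellGF {n : WithTop ℕ∞} : ContDiff ℂ n bellGF := by
  unfold bellGF
  fun_prop

theorem deriv_bellGF : deriv bellGF = fun z => Complex.exp z * bellGF z := by
  ext z
  have := ((Complex.hasDerivAt_exp z).sub_const 1).cexp
  rw [show bellGF = fun z => Complex.exp (Complex.exp z - 1) from rfl, this.deriv, mul_comm]

theorem iteratedDeriv_bellGF_zero (n : ℕ) : iteratedDeriv n bellGF 0 = Nat.bell n := by
  induction n using Nat.strong_induction_on with
  | _ n ih =>
  obtain _ | n := n
  · simp [bellGF]
  · rw [iteratedDeriv_succ', deriv_bellGF,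
      iteratedDeriv_fun_mul Complex.contDiff_exp.contDiffAt contDiff_bellGF.contDiffAt,
      Nat.bell_succ, Nat.range_succ_eq_Iic]
    push_cast
    refine Finset.sum_congr rfl fun i hi => ?_
    rw [ih (n - i) (by omega), iteratedDeriv_eq_iterate, Complex.iter_deriv_exp]
    simp

/-- The exponential generating function of the popularity of left children. -/
noncomputable def popularityGF (z : ℂ) : ℂ :=
  (z * Complex.exp z - Complex.exp z + 1) * bellGF z

theorem contDiff_popularityGF {n : WithTop ℕ∞} : ContDiff ℂ n popularityGF := by
  unfold popularityGF bellGF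
  fun_prop

theorem popularityGF_eq_deriv : popularityGF = deriv (fun z => z * bellGF z - bellGF z) := by
  ext z
  have h : HasDerivAt bellGF (Complex.exp z * bellGF z) z := by
    have := ((contDiff_bellGF (n := 1)).differentiable one_ne_zero z).hasDerivAt
    rwa [deriv_bellGF] at this
  rw [(((hasDerivAt_id' z).fun_mul h).fun_sub h).deriv, popularityGF]
  ring

theorem iteratedDeriv_popularityGF_zero (n : ℕ) :
    iteratedDeriv n popularityGF 0 = (n + 1) * Nat.bell n - Nat.bell (n + 1) := by
  have h1 : ContDiffAt ℂ (n + 1 : ℕ) (fun z : ℂ => z) 0 := contDiffAt_id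
  have h2 : ContDiffAt ℂ (n + 1 : ℕ) bellGF 0 := contDiff_bellGF.contDiffAt
  rw [popularityGF_eq_deriv, ← iteratedDeriv_succ', iteratedDeriv_fun_sub (h1.mul h2) h2,
    iteratedDeriv_fun_mul h1 h2, iteratedDeriv_bellGF_zero]
  congr 1
  -- In the Leibniz sum only the first derivative of `z` is nonzero at `0`.
  rw [Finset.sum_eq_single 1]
  · rw [iteratedDeriv_bellGF_zero, iteratedDeriv_fun_id_zero]
    simp
  · intro i _ hi
    rw [iteratedDeriv_fun_id_zero, if_neg hi]
    simp
  · simp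

open Complex in
/-- The integrand of Cauchy's formula for the coefficients of `popularityGF` on the circle of
radius `r`, divided by its value at `θ = 0` up to an exponentially small factor, when the index is
`r * exp r`. -/
noncomputable def saddleKernel (r θ : ℝ) : ℂ :=
  (circleMap 0 r θ * exp (circleMap 0 r θ) - exp (circleMap 0 r θ) + 1) / (r * exp r) *
    exp (exp (circleMap 0 r θ) - exp r - r * exp r * θ * I)

open Complex in
theorem iteratedDeriv_popularityGF_eq_integral {n : ℕ} {r : ℝ} (hr : 0 < r)
    (hn : r * Real.exp r = n) :
    iteratedDeriv n popularityGF 0 = n.factorial / (2 * Real.pi) * ((r : ℂ) ^ n)⁻¹ * n *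
      exp (exp r - 1) * ∫ θ in (-Real.pi)..Real.pi, saddleKernel r θ := by
  have hd : DiffContOnCl ℂ popularityGF (Metric.ball 0 r) :=
    ((contDiff_popularityGF (n := 1)).differentiable one_ne_zero).diffContOnCl
  have h := hd.circleIntegral_one_div_sub_center_pow_smul hr n
  have hn' : (r : ℂ) * exp r = n := by exact_mod_cast congrArg ((↑) : ℝ → ℂ) hn
  have hr' : (r : ℂ) ≠ 0 := by exact_mod_cast hr.ne'
  have hper : Function.Periodic (fun θ : ℝ => deriv (circleMap 0 r) θ •
      ((1 / (circleMap 0 r θ - 0) ^ (n + 1)) • popularityGF (circleMap 0 r θ)))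
      (2 * Real.pi) := by
    intro θ
    simp only [deriv_circleMap, periodic_circleMap 0 r θ]
  have hI : (∮ z in C(0, r), (1 / (z - 0) ^ (n + 1)) • popularityGF z) =
      ∫ θ in (-Real.pi)..Real.pi, I * ((r : ℂ) ^ n)⁻¹ * n * exp (exp r - 1) * saddleKernel r θ := by
    -- Periodicity moves `[0, 2π]` to `[-π, π]`, making the saddle `θ = 0` an interior point.
    have h1 := hper.intervalIntegral_add_eq 0 (-Real.pi)
    rw [circleIntegral, show (2 : ℝ) * Real.pi = 0 + 2 * Real.pi by ring, h1,
      show -Real.pi + 2 * Real.pi = Real.pi by ring]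
    congr 1
    ext θ
    have hz : circleMap 0 r θ = r * exp (θ * I) := by simp [circleMap]
    have hz0 : circleMap 0 r θ ≠ 0 := by simp [hz, hr']
    have hpow : circleMap 0 r θ ^ n = r ^ n * exp (n * θ * I) := by
      rw [hz, mul_pow, ← exp_nat_mul]
      ring_nf
    have hE : exp (exp (circleMap 0 r θ) - 1) = exp (exp r - 1) *
        exp (exp (circleMap 0 r θ) - exp r - r * exp r * θ * I) * exp (n * θ * I) := by
      rw [← exp_add, ← exp_add, hn']
      ring_nf
    have hn0 : (n : ℂ) ≠ 0 := by
      rw [← hn']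
      simp [hr']
    rw [deriv_circleMap, saddleKernel, popularityGF, bellGF, hE, hn', sub_zero, pow_succ, hpow]
    have := exp_ne_zero (n * θ * I)
    simp only [smul_eq_mul]
    field_simp
  rw [hI, intervalIntegral.integral_const_mul, smul_eq_mul] at h
  have hf : (n.factorial : ℂ) ≠ 0 := by exact_mod_cast n.factorial_ne_zero
  have hpi : (Real.pi : ℂ) ≠ 0 := by exact_mod_cast Real.pi_ne_zero
  have hI0 := I_ne_zero
  field_simp at h ⊢
  linear_combination -h

/-! ### Local expansion and global bounds of the kernel -/

open Complex in
theorem norm_exp_I_mul_sub_le {θ : ℝ} (hθ : |θ| ≤ 1) :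
    ‖exp (θ * I) - 1 - θ * I‖ ≤ |θ| ^ 2 ∧
      ‖exp (θ * I) - 1 - θ * I + θ ^ 2 / 2‖ ≤ |θ| ^ 3 := by
  have hn : ‖(θ * I : ℂ)‖ = |θ| := by simp
  constructor
  · simpa [hn] using norm_exp_sub_one_sub_id_le (x := θ * I) (by rwa [hn])
  · have h := exp_bound (x := θ * I) (by rwa [hn]) (n := 3) (by norm_num)
    rw [hn] at h
    refine le_trans (le_of_eq ?_) (h.trans ?_)
    · congr 1
      simp [Finset.sum_range_succ, mul_pow]
      ring
    · have : 0 ≤ |θ| ^ 3 := by positivity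
      norm_num [Nat.factorial]
      linarith

open Complex in
-- Three errors of size at most `(r * |θ|) ^ 3` add up: the Taylor remainder of `exp u`, that of
-- `exp (θ * I)` scaled by `r`, and the replacement of `u ^ 2` by `-(r * θ) ^ 2`, factored as a
-- difference of squares.
theorem norm_exp_circleMap_expansion {r θ : ℝ} (hr : 1 ≤ r) (hθ : r * |θ| ≤ 1) :
    ‖exp (circleMap 0 r θ - r) - 1 - r * θ * I + (r + r ^ 2) * θ ^ 2 / 2‖ ≤
      3 * (r * |θ|) ^ 3 := by
  set u : ℂ := circleMap 0 r θ - r with hu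
  have hu' : u = r * (exp (θ * I) - 1) := by
    rw [hu, circleMap]
    ring
  have habs : 0 ≤ |θ| := abs_nonneg θ
  have hθ1 : |θ| ≤ 1 := by nlinarith
  obtain ⟨h1, h2⟩ := norm_exp_I_mul_sub_le hθ1
  have hrn : ‖(r : ℂ)‖ = r := by simp [abs_of_nonneg (zero_le_one.trans hr)]
  have h0 : ‖exp (θ * I) - 1‖ ≤ |θ| := by
    simpa [mul_comm] using Real.norm_exp_I_mul_ofReal_sub_one_le (x := θ)
  have hun : ‖u‖ ≤ r * |θ| := by
    rw [hu', norm_mul, hrn]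
    gcongr
  have h3 : ‖exp u - 1 - u - u ^ 2 / 2‖ ≤ (r * |θ|) ^ 3 := by
    have h := exp_bound (x := u) (hun.trans hθ) (n := 3) (by norm_num)
    refine le_trans (le_of_eq ?_) (h.trans (le_trans ?_ (pow_le_pow_left₀ (norm_nonneg u) hun 3)))
    · congr 1
      simp [Finset.sum_range_succ]
      ring
    · have : 0 ≤ ‖u‖ ^ 3 := by positivity
      norm_num [Nat.factorial]
      linarith
  have h4 : ‖(r : ℂ) * (exp (θ * I) - 1 - θ * I + θ ^ 2 / 2)‖ ≤ (r * |θ|) ^ 3 := by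
    rw [norm_mul, hrn, mul_pow]
    gcongr
    exact le_self_pow₀ hr (by norm_num)
  have h5 : ‖(u - r * θ * I) * (u + r * θ * I) / 2‖ ≤ (r * |θ|) ^ 3 := by
    have ha : ‖u - r * θ * I‖ ≤ r * |θ| ^ 2 := by
      rw [hu', show (r : ℂ) * (exp (θ * I) - 1) - r * θ * I = r * (exp (θ * I) - 1 - θ * I) by ring,
        norm_mul, hrn]
      gcongr
    have hb : ‖u + r * θ * I‖ ≤ 2 * (r * |θ|) := by
      refine (norm_add_le _ _).trans ?_
      have : ‖(r * θ * I : ℂ)‖ = r * |θ| := by simp [abs_of_nonneg (zero_le_one.trans hr)]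
      linarith
    rw [norm_div, norm_mul, Complex.norm_two]
    calc ‖u - r * θ * I‖ * ‖u + r * θ * I‖ / 2 ≤ (r * |θ| ^ 2) * (2 * (r * |θ|)) / 2 := by gcongr
      _ = r ^ 2 * |θ| ^ 3 := by ring
      _ ≤ r ^ 3 * |θ| ^ 3 := by gcongr; norm_num
      _ = _ := by ring
  have : exp u - 1 - r * θ * I + (r + r ^ 2) * θ ^ 2 / 2 = (exp u - 1 - u - u ^ 2 / 2) +
      r * (exp (θ * I) - 1 - θ * I + θ ^ 2 / 2) + (u - r * θ * I) * (u + r * θ * I) / 2 := by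
    linear_combination hu' + r ^ 2 * θ ^ 2 / 2 * I_sq
  rw [this]
  refine (norm_add₃_le).trans ?_
  linarith

/-- The standard deviation of the saddle-point approximation. -/
noncomputable def saddleScale (r : ℝ) : ℝ := √(r * (r + 1) * Real.exp r)

theorem saddleScale_sq {r : ℝ} (hr : 0 ≤ r) :
    saddleScale r ^ 2 = r * (r + 1) * Real.exp r := by
  rw [saddleScale, Real.sq_sqrt (by positivity)]

theorem saddleScale_pos {r : ℝ} (hr : 0 < r) : 0 < saddleScale r := by
  unfold saddleScale
  positivity

theorem le_saddleScale {r : ℝ} (hr : 0 ≤ r) : r * Real.exp (r / 2) ≤ saddleScale r := by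
  refine Real.le_sqrt_of_sq_le ?_
  rw [mul_pow, ← Real.exp_nat_mul]
  have : ((2 : ℕ) : ℝ) * (r / 2) = r := by push_cast; ring
  rw [this]
  gcongr
  nlinarith

open Complex in
theorem norm_saddleKernel_le {r : ℝ} (hr : 1 ≤ r) (θ : ℝ) :
    ‖saddleKernel r θ‖ ≤
      3 * Real.exp (Real.exp (r * Real.cos θ) * Real.cos (r * Real.sin θ) - Real.exp r) := by
  have hr0 : 0 < r := by linarith
  set z := circleMap 0 r θ with hz
  have hzre : z.re = r * Real.cos θ := by simp [hz, circleMap, exp_ofReal_mul_I_re]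
  have hzim : z.im = r * Real.sin θ := by simp [hz, circleMap, exp_ofReal_mul_I_im]
  have hzn : ‖z‖ = r := by simp [hz, abs_of_pos hr0]
  have hez : ‖exp z‖ ≤ Real.exp r := by
    rw [norm_exp, Real.exp_le_exp]
    exact (re_le_norm z).trans hzn.le
  have he1 : 1 ≤ Real.exp r := Real.one_le_exp hr0.le
  rw [saddleKernel, norm_mul, ← hz]
  have hA : ‖(z * exp z - exp z + 1) / (r * exp r)‖ ≤ 3 := by
    have hden : ‖(r * exp r : ℂ)‖ = r * Real.exp r := by
      rw [norm_mul, norm_exp]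
      simp [abs_of_pos hr0]
    rw [norm_div, hden, div_le_iff₀ (by positivity)]
    calc ‖z * exp z - exp z + 1‖ ≤ ‖z * exp z‖ + ‖exp z‖ + 1 := by
          refine (norm_add_le _ _).trans ?_
          rw [norm_one]
          gcongr
          exact norm_sub_le _ _
      _ ≤ r * Real.exp r + Real.exp r + Real.exp r := by
          rw [norm_mul, hzn]
          gcongr
      _ ≤ _ := by nlinarith
  have hB : ‖exp (exp z - exp r - r * exp r * θ * I)‖ =
      Real.exp (Real.exp (r * Real.cos θ) * Real.cos (r * Real.sin θ) - Real.exp r) := by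
    rw [norm_exp]
    congr 1
    have : (r * exp r * θ * I : ℂ) = ((r * Real.exp r * θ : ℝ) : ℂ) * I := by push_cast; ring
    rw [this, ← ofReal_exp, sub_re, sub_re, exp_re, hzre, hzim, re_ofReal_mul, I_re, ofReal_re, mul_zero, sub_zero]
  rw [hB]
  gcongr

/-- Near the saddle the decay comes from `cos (r * sin θ)`: `cos x ≤ 1 - 2x²/π²` and `|sin θ| ≥
2|θ|/π` give the constant `8/π⁴` with `r²`, and `r + 1 ≤ 2r` halves it. -/
theorem exp_sub_le_central {r θ : ℝ} (hr : 1 ≤ r) (hθ : r * |θ| ≤ 1) :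
    Real.exp (r * Real.cos θ) * Real.cos (r * Real.sin θ) - Real.exp r ≤
      -(4 / Real.pi ^ 4) * (saddleScale r * θ) ^ 2 := by
  have hr0 : 0 < r := by linarith
  have hpi := Real.pi_gt_three
  have hθ1 : |θ| ≤ 1 := by nlinarith [abs_nonneg θ]
  have hsin : |Real.sin θ| ≤ |θ| := Real.abs_sin_le_abs
  have hsin' : 2 / Real.pi * |θ| ≤ |Real.sin θ| :=
    Real.mul_abs_le_abs_sin (by linarith)
  have hx : |r * Real.sin θ| ≤ 1 := by
    rw [abs_mul, abs_of_pos hr0]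
    nlinarith
  have hc := Real.cos_le_one_sub_mul_cos_sq (x := r * Real.sin θ) (by linarith)
  have hc0 : 0 ≤ Real.cos (r * Real.sin θ) := by
    have := Real.one_sub_sq_div_two_le_cos (x := r * Real.sin θ)
    have : (r * Real.sin θ) ^ 2 ≤ 1 := by
      rw [← sq_abs]
      exact pow_le_one₀ (abs_nonneg _) hx
    linarith
  have hs2 : (2 / Real.pi) ^ 2 * θ ^ 2 ≤ Real.sin θ ^ 2 := by
    rw [← mul_pow, ← sq_abs (Real.sin θ), ← sq_abs (2 / Real.pi * θ), abs_mul,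
      abs_of_pos (by positivity : 0 < 2 / Real.pi)]
    gcongr
  have h1 : Real.exp (r * Real.cos θ) * Real.cos (r * Real.sin θ) ≤
      Real.exp r * Real.cos (r * Real.sin θ) := by
    gcongr
    nlinarith [Real.cos_le_one θ]
  have h2 : Real.exp r * Real.cos (r * Real.sin θ) ≤
      Real.exp r * (1 - 2 / Real.pi ^ 2 * (r ^ 2 * ((2 / Real.pi) ^ 2 * θ ^ 2))) := by
    refine mul_le_mul_of_nonneg_left (hc.trans ?_) (Real.exp_pos r).le
    rw [mul_pow]
    gcongr
  have h3 : (4 / Real.pi ^ 4) * (saddleScale r * θ) ^ 2 ≤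
      Real.exp r * (2 / Real.pi ^ 2 * (r ^ 2 * ((2 / Real.pi) ^ 2 * θ ^ 2))) := by
    rw [mul_pow, saddleScale_sq hr0.le]
    have : Real.exp r * (2 / Real.pi ^ 2 * (r ^ 2 * ((2 / Real.pi) ^ 2 * θ ^ 2))) =
      (4 / Real.pi ^ 4) * ((r * (2 * r)) * Real.exp r * θ ^ 2) := by
      field_simp
      ring
    rw [this]
    gcongr
    linarith
  linarith

/-- Away from the saddle the decay comes from `exp (r * cos θ)`: the exponent drops by at least `x =
2 / (π² r)`, and `exp (-x) ≤ 1 - x / 2`. -/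
theorem exp_sub_le_outer {r θ : ℝ} (hr : 1 ≤ r) (hθ : 1 ≤ r * |θ|) (hθ' : |θ| ≤ Real.pi) :
    Real.exp (r * Real.cos θ) * Real.cos (r * Real.sin θ) - Real.exp r ≤
      -(Real.exp r / (Real.pi ^ 2 * r)) := by
  have hr0 : 0 < r := by linarith
  have hpi := Real.pi_gt_three
  have hc := Real.cos_le_one_sub_mul_cos_sq hθ'
  set x := 2 / (Real.pi ^ 2 * r) with hx
  have hx0 : 0 < x := by positivity
  have hx1 : x ≤ 1 := by
    rw [hx, div_le_one (by positivity)]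
    nlinarith
  have h1 : r * Real.cos θ ≤ r - x := by
    have h2 : 1 ≤ r ^ 2 * θ ^ 2 := by
      rw [← sq_abs θ, ← mul_pow]
      exact one_le_pow₀ hθ
    have h3 : x ≤ r * (2 / Real.pi ^ 2 * θ ^ 2) := by
      rw [hx, show r * (2 / Real.pi ^ 2 * θ ^ 2) = 2 / (Real.pi ^ 2 * r) * (r ^ 2 * θ ^ 2) by
        field_simp]
      exact le_mul_of_one_le_right (by positivity) h2
    nlinarith
  have h4 : Real.exp (-x) ≤ 1 - x / 2 := by
    have h5 : 1 + x ≤ Real.exp x := by linarith [Real.add_one_le_exp x]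
    rw [Real.exp_neg, inv_le_comm₀ (Real.exp_pos x) (by linarith)]
    refine le_trans ?_ h5
    rw [inv_le_iff_one_le_mul₀ (by linarith)]
    nlinarith
  calc Real.exp (r * Real.cos θ) * Real.cos (r * Real.sin θ) - Real.exp r
      ≤ Real.exp (r * Real.cos θ) * 1 - Real.exp r := by
        gcongr
        exact Real.cos_le_one _
    _ ≤ Real.exp (r - x) - Real.exp r := by
        rw [mul_one]
        gcongr
    _ = Real.exp r * Real.exp (-x) - Real.exp r := by rw [← Real.exp_add, sub_eq_add_neg r]
    _ ≤ Real.exp r * (1 - x / 2) - Real.exp r := by gcongr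
    _ = _ := by rw [hx]; field_simp; ring

/-! ### Convergence of the rescaled integral -/

open Filter Topology Asymptotics

theorem continuous_saddleKernel (r : ℝ) : Continuous (saddleKernel r) := by
  unfold saddleKernel
  have := continuous_circleMap 0 r
  fun_prop

/-- The Gaussian covers the central zone. Outside it, `hr'` yields a bound `exp (-2r)`, which is
below `(1 + t²)⁻¹` because `t² ≤ π² * saddleScale r ^ 2`; the constant 30 leaves room for both
estimates. -/
theorem norm_saddleKernel_div_le {r t : ℝ} (hr : 1 ≤ r) (hr' : 30 * r ^ 2 ≤ Real.exp r)
    (ht : |t| ≤ Real.pi * saddleScale r) :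
    ‖saddleKernel r (t / saddleScale r)‖ ≤
      3 * (Real.exp (-(4 / Real.pi ^ 4) * t ^ 2) + (1 + t ^ 2)⁻¹) := by
  have hr0 : 0 < r := by linarith
  have hs := saddleScale_pos hr0
  refine (norm_saddleKernel_le hr _).trans ?_
  gcongr
  rcases le_total (r * |t / saddleScale r|) 1 with h | h
  · refine le_add_of_le_of_nonneg (Real.exp_le_exp.2 ?_) (by positivity)
    refine (exp_sub_le_central hr h).trans (le_of_eq ?_)
    rw [mul_div_cancel₀ _ hs.ne']
  · refine le_add_of_nonneg_of_le (Real.exp_pos _).le ?_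
    have hθ : |t / saddleScale r| ≤ Real.pi := by
      rwa [abs_div, abs_of_pos hs, div_le_iff₀ hs]
    refine (Real.exp_le_exp.2 (exp_sub_le_outer hr h hθ)).trans ?_
    rw [Real.exp_neg]
    refine inv_anti₀ (by positivity) ?_
    have hpi : Real.pi ^ 2 ≤ 10 := by nlinarith [Real.pi_lt_d2, Real.pi_gt_three]
    have ht2 : t ^ 2 ≤ 10 * (r * (r + 1) * Real.exp r) := by
      rw [← saddleScale_sq hr0.le, ← sq_abs]
      calc |t| ^ 2 ≤ (Real.pi * saddleScale r) ^ 2 := by gcongr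
        _ ≤ _ := by rw [mul_pow]; gcongr
    have h1 : 2 * r ≤ Real.exp r / (Real.pi ^ 2 * r) := by
      rw [le_div_iff₀ (by positivity)]
      nlinarith [mul_le_mul_of_nonneg_left hpi (by positivity : 0 ≤ 2 * r * r)]
    have h2 : Real.exp (2 * r) = Real.exp r * Real.exp r := by rw [← Real.exp_add]; ring_nf
    refine le_trans ?_ (Real.exp_le_exp.2 h1)
    rw [h2]
    have he1 : 1 ≤ Real.exp r := Real.one_le_exp hr0.le
    calc 1 + t ^ 2 ≤ Real.exp r * (1 + 10 * (r * (r + 1))) := by linarith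
      _ ≤ _ := by
        gcongr
        nlinarith

open Complex in
theorem tendsto_saddleKernel_div (t : ℝ) :
    Tendsto (fun r => saddleKernel r (t / saddleScale r)) atTop
      (𝓝 ((Real.exp (-(1 / 2) * t ^ 2) : ℝ) : ℂ)) := by
  have hdecay : Tendsto (fun r : ℝ => Real.exp (-(r / 2))) atTop (𝓝 0) :=
    Real.tendsto_exp_neg_atTop_nhds_zero.comp (tendsto_id.atTop_div_const two_pos)
  have hδ : ∀ r : ℝ, 1 ≤ r → r * |t / saddleScale r| ≤ |t| * Real.exp (-(r / 2)) := by
    intro r hr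
    have hr0 : 0 < r := by linarith
    have hs := saddleScale_pos hr0
    rw [abs_div, abs_of_pos hs, ← mul_div_assoc, div_le_iff₀ hs]
    calc r * |t| = |t| * Real.exp (-(r / 2)) * (r * Real.exp (r / 2)) := by
          rw [Real.exp_neg]
          field_simp
      _ ≤ _ := by
          gcongr
          exact le_saddleScale hr0.le
  have hδ0 : Tendsto (fun r : ℝ => |t| * Real.exp (-(r / 2))) atTop (𝓝 0) := by
    simpa using hdecay.const_mul |t|
  have hδ1 : ∀ᶠ r : ℝ in atTop, |t| * Real.exp (-(r / 2)) ≤ 1 :=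
    hδ0.eventually_le_const one_pos
  have hθ : Tendsto (fun r : ℝ => ((t / saddleScale r : ℝ) : ℂ)) atTop (𝓝 0) := by
    rw [tendsto_zero_iff_norm_tendsto_zero]
    refine squeeze_zero' (Eventually.of_forall fun _ => norm_nonneg _) ?_ hδ0
    filter_upwards [eventually_ge_atTop 1] with r hr
    rw [norm_real, Real.norm_eq_abs]
    exact (le_mul_of_one_le_left (abs_nonneg _) hr).trans (hδ r hr)
  have hu : Tendsto (fun r : ℝ => circleMap 0 r (t / saddleScale r) - r) atTop (𝓝 0) := by
    rw [tendsto_zero_iff_norm_tendsto_zero]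
    refine squeeze_zero' (Eventually.of_forall fun _ => norm_nonneg _) ?_ hδ0
    filter_upwards [eventually_ge_atTop 1] with r hr
    refine le_trans ?_ (hδ r hr)
    have : circleMap 0 r (t / saddleScale r) - r =
        r * (exp (I * (t / saddleScale r : ℝ)) - 1) := by
      rw [circleMap, mul_comm I]
      ring
    rw [this, norm_mul, norm_real, Real.norm_eq_abs, abs_of_nonneg (by linarith)]
    gcongr
    exact Real.norm_exp_I_mul_ofReal_sub_one_le
  have heu : Tendsto (fun r : ℝ => exp (circleMap 0 r (t / saddleScale r) - r)) atTop (𝓝 1) := by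
    simpa using hu.cexp
  have hiθ : Tendsto (fun r : ℝ => exp ((t / saddleScale r : ℝ) * I)) atTop (𝓝 1) := by
    simpa using (hθ.mul_const I).cexp
  have hinv : Tendsto (fun r : ℝ => ((r⁻¹ : ℝ) : ℂ)) atTop (𝓝 0) := by
    rw [← ofReal_zero]
    exact (continuous_ofReal.tendsto 0).comp tendsto_inv_atTop_zero
  have hexpinv : Tendsto (fun r : ℝ => ((Real.exp (-r) : ℝ) : ℂ)) atTop (𝓝 0) := by
    rw [← ofReal_zero]
    exact (continuous_ofReal.tendsto 0).comp Real.tendsto_exp_neg_atTop_nhds_zero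
  -- The prefactor of the kernel, after division by `r * exp r`, in the form `exp (θ * I) * exp u -
  -- exp u / r + exp (-r) / r`, which tends to `1`.
  have hA := ((hiθ.mul heu).sub (hinv.mul heu)).add (hinv.mul hexpinv)
  have hE : Tendsto (fun r : ℝ => exp (circleMap 0 r (t / saddleScale r)) - exp r -
      r * exp r * (t / saddleScale r : ℝ) * I) atTop (𝓝 ((-(1 / 2) * t ^ 2 : ℝ) : ℂ)) := by
    rw [tendsto_iff_norm_sub_tendsto_zero]
    have hlim : Tendsto (fun r : ℝ => 3 * |t| ^ 3 * Real.exp (-(r / 2))) atTop (𝓝 0) := by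
      simpa using hdecay.const_mul (3 * |t| ^ 3)
    refine squeeze_zero' (Eventually.of_forall fun _ => norm_nonneg _) ?_ hlim
    filter_upwards [eventually_ge_atTop 1, hδ1] with r hr h1
    have hr0 : 0 < r := by linarith
    set θ := t / saddleScale r with hθdef
    have hb := norm_exp_circleMap_expansion hr ((hδ r hr).trans h1)
    have ht : Real.exp r * ((r + r ^ 2) * θ ^ 2) = t ^ 2 := by
      have hs := saddleScale_pos hr0
      rw [hθdef, div_pow, saddleScale_sq hr0.le]
      field_simp
      ring
    have ht' : exp r * ((r + r ^ 2) * (θ : ℂ) ^ 2) = t ^ 2 := by exact_mod_cast ht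
    have heq : exp (circleMap 0 r θ) - exp r - r * exp r * θ * I -
        ((-(1 / 2) * t ^ 2 : ℝ) : ℂ) = exp r *
        (exp (circleMap 0 r θ - r) - 1 - r * θ * I + (r + r ^ 2) * θ ^ 2 / 2) := by
      rw [exp_sub]
      push_cast
      rw [← ht']
      have := exp_ne_zero (r : ℂ)
      field_simp
      ring
    rw [heq, norm_mul, norm_exp, ofReal_re]
    -- The cubic error beats the factor `exp r`, since `exp r * exp (-(r / 2)) ^ 3 = exp (-(r /
    -- 2))`.
    calc Real.exp r * _ ≤ Real.exp r * (3 * (r * |θ|) ^ 3) := by gcongr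
      _ ≤ Real.exp r * (3 * (|t| * Real.exp (-(r / 2))) ^ 3) :=
        mul_le_mul_of_nonneg_left (mul_le_mul_of_nonneg_left
          (pow_le_pow_left₀ (by positivity) (hδ r hr) 3) (by norm_num)) (Real.exp_pos r).le
      _ = 3 * |t| ^ 3 * (Real.exp r * Real.exp (-(r / 2)) ^ 3) := by ring
      _ = _ := by
        rw [← Real.exp_nat_mul, ← Real.exp_add]
        congr 2
        push_cast
        ring
  have := hA.mul hE.cexp
  have hl : ((1 * 1 - 0 * 1 + 0 * 0) * exp ((-(1 / 2) * t ^ 2 : ℝ) : ℂ) : ℂ) =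
      ((Real.exp (-(1 / 2) * t ^ 2) : ℝ) : ℂ) := by
    rw [ofReal_exp]
    ring
  rw [hl] at this
  refine this.congr' ?_
  filter_upwards [eventually_gt_atTop 0] with r hr
  rw [saddleKernel]
  congr 1
  have hr' : (r : ℂ) ≠ 0 := by exact_mod_cast hr.ne'
  have := exp_ne_zero (r : ℂ)
  have hz : circleMap 0 r (t / saddleScale r) = r * exp ((t / saddleScale r : ℝ) * I) := by
    simp [circleMap]
  rw [exp_sub, ofReal_exp, ofReal_neg, exp_neg, ofReal_inv]
  generalize exp (circleMap 0 r (t / saddleScale r)) = w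
  rw [hz]
  field_simp

open Set MeasureTheory in
theorem tendsto_saddleScale_mul_integral :
    Tendsto (fun r => (saddleScale r : ℂ) * ∫ θ in (-Real.pi)..Real.pi, saddleKernel r θ) atTop
      (𝓝 (√(2 * Real.pi) : ℝ)) := by
  have hpi := Real.pi_pos
  -- The substitution `t = saddleScale r * θ`, extended by zero, puts all integrals on the whole
  -- line.
  let F : ℝ → ℝ → ℂ := fun r =>
    indicator (Ioc (-(Real.pi * saddleScale r)) (Real.pi * saddleScale r)) fun t => saddleKernel r (t / saddleScale r)
  have hF : ∀ᶠ r in atTop, ∫ t, F r t =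
      (saddleScale r : ℂ) * ∫ θ in (-Real.pi)..Real.pi, saddleKernel r θ := by
    filter_upwards [eventually_gt_atTop 0] with r hr
    have hs := saddleScale_pos hr
    rw [integral_indicator measurableSet_Ioc, ← intervalIntegral.integral_of_le,
      intervalIntegral.integral_comp_div _ hs.ne', neg_div, mul_div_cancel_right₀ _ hs.ne',
      Complex.real_smul]
    have := mul_pos hpi hs
    linarith
  have hlim : ∫ t : ℝ, ((Real.exp (-(1 / 2) * t ^ 2) : ℝ) : ℂ) = (√(2 * Real.pi) : ℝ) := by
    rw [integral_complex_ofReal, integral_gaussian]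
    congr 2
    ring
  rw [← hlim]
  refine Tendsto.congr' hF ?_
  have hexp : ∀ᶠ r : ℝ in atTop, 30 * r ^ 2 ≤ Real.exp r := by
    filter_upwards [(Real.tendsto_exp_div_pow_atTop 2).eventually_ge_atTop 30,
      eventually_gt_atTop 0] with r h hr
    rwa [le_div_iff₀ (by positivity)] at h
  refine tendsto_integral_filter_of_dominated_convergence
    (fun t => 3 * (Real.exp (-(4 / Real.pi ^ 4) * t ^ 2) + (1 + t ^ 2)⁻¹)) ?_ ?_ ?_ ?_
  · refine Eventually.of_forall fun r => ?_
    exact ((continuous_saddleKernel r).comp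
      (continuous_id.div_const _)).aestronglyMeasurable.indicator measurableSet_Ioc
  · filter_upwards [hexp, eventually_ge_atTop 1] with r h1 h2
    refine Eventually.of_forall fun t => ?_
    by_cases ht : t ∈ Ioc (-(Real.pi * saddleScale r)) (Real.pi * saddleScale r)
    · simp only [F, indicator_of_mem ht]
      exact norm_saddleKernel_div_le h2 h1 (abs_le.2 ⟨ht.1.le, ht.2⟩)
    · simp only [F, indicator_of_notMem ht, norm_zero]
      positivity
  · exact ((integrable_exp_neg_mul_sq (by positivity)).add integrable_inv_one_add_sq).const_mul 3
  · refine Eventually.of_forall fun t => (tendsto_saddleKernel_div t).congr' ?_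
    filter_upwards [eventually_ge_atTop 1,
      tendsto_id.eventually_ge_atTop (|t|)] with r hr ht
    have hr0 : 0 < r := by linarith
    have hlt : |t| < Real.pi * saddleScale r := by
      have h1 := le_saddleScale hr0.le
      have h2 : 1 ≤ Real.exp (r / 2) := Real.one_le_exp (by linarith)
      have h3 : |t| ≤ r := ht
      have h4 : r ≤ saddleScale r := (le_mul_of_one_le_right hr0.le h2).trans h1
      nlinarith [Real.pi_gt_three]
    have := abs_lt.1 hlt
    simp only [F]
    rw [indicator_of_mem (show t ∈ Ioc _ _ from ⟨this.1, this.2.le⟩)]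

/-! ### The Lambert function and the final asymptotics -/

theorem existsUnique_mul_exp_eq {x : ℝ} (hx : 0 ≤ x) : ∃! w : ℝ, w * Real.exp w = x := by
  have hnn : ∀ w : ℝ, w * Real.exp w = x → 0 ≤ w := fun w hw =>
    nonneg_of_mul_nonneg_left (hw ▸ hx) (Real.exp_pos w)
  have hmono : StrictMonoOn (fun w : ℝ => w * Real.exp w) (Set.Ici 0) := by
    intro a ha b _ hab
    exact mul_lt_mul hab (Real.exp_le_exp.2 hab.le) (Real.exp_pos a) (le_trans ha hab.le)
  have hc : ContinuousOn (fun w : ℝ => w * Real.exp w) (Set.Icc 0 x) := by fun_prop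
  obtain ⟨w, -, hw⟩ := intermediate_value_Icc hx hc
    (show x ∈ Set.Icc _ _ from ⟨by simpa using hx, le_mul_of_one_le_right hx (Real.one_le_exp hx)⟩)
  exact ⟨w, hw, fun v hv => hmono.injOn (hnn v hv) (hnn w hw) (hv.trans hw.symm)⟩

theorem pos_of_mul_exp_pos {w x : ℝ} (h : w * Real.exp w = x) (hx : 0 < x) : 0 < w :=
  pos_of_mul_pos_left (h ▸ hx) (Real.exp_pos w).le

theorem tendsto_atTop_of_mul_exp_eq {W : ℕ → ℝ} (hW : ∀ n : ℕ, W n * Real.exp (W n) = n) :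
    Tendsto W atTop atTop := by
  rw [tendsto_atTop]
  intro C
  filter_upwards [tendsto_natCast_atTop_atTop.eventually_gt_atTop (C * Real.exp C),
    eventually_gt_atTop 0] with n hn hn0
  by_contra! h
  have hpos := pos_of_mul_exp_pos (hW n) (Nat.cast_pos.2 hn0)
  have : W n * Real.exp (W n) ≤ C * Real.exp C := by
    have := hpos.trans h
    gcongr
  rw [hW n] at this
  exact absurd this (not_le.2 hn)

namespace Treeshelf

theorem popularity_leftRight_eq_integral {n : ℕ} {r : ℝ} (hr : 0 < r)
    (hn : r * Real.exp r = n) :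
    (popularity leftRight n : ℝ) = n.factorial / (2 * Real.pi) * (r ^ n)⁻¹ * n *
      Real.exp (Real.exp r - 1) / saddleScale r *
        ((saddleScale r : ℂ) * ∫ θ in (-Real.pi)..Real.pi, saddleKernel r θ).re := by
  have h := iteratedDeriv_popularityGF_eq_integral hr hn
  have hp : (popularity leftRight n : ℂ) = ((n : ℂ) + 1) * Nat.bell n - Nat.bell (n + 1) := by
    exact_mod_cast congrArg (Int.cast (R := ℂ)) (popularity_leftRight n)
  rw [iteratedDeriv_popularityGF_zero, ← hp] at h
  have hs : (saddleScale r : ℂ) ≠ 0 := by exact_mod_cast (saddleScale_pos hr).ne'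
  have h' : (popularity leftRight n : ℂ) = ((n.factorial / (2 * Real.pi) * (r ^ n)⁻¹ * n *
      Real.exp (Real.exp r - 1) / saddleScale r : ℝ) : ℂ) *
        ((saddleScale r : ℂ) * ∫ θ in (-Real.pi)..Real.pi, saddleKernel r θ) := by
    rw [h]
    push_cast
    field_simp
  have := congrArg Complex.re h'
  rwa [Complex.re_ofReal_mul, Complex.natCast_re] at this

theorem isEquivalent_popularity_leftRight {W : ℕ → ℝ}
    (hW : ∀ n : ℕ, W n * Real.exp (W n) = n) :
    (fun n : ℕ => (popularity leftRight n : ℝ)) ~[atTop]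
      fun n : ℕ => √(n : ℝ) * ((n : ℝ) / W n) ^ ((n : ℝ) + 1 / 2) *
        Real.exp ((n : ℝ) / W n - (n : ℝ) - 1) := by
  have hpi := Real.pi_pos
  have hWtop := tendsto_atTop_of_mul_exp_eq hW
  have hre : Tendsto (fun n => ((saddleScale (W n) : ℂ) *
      ∫ θ in (-Real.pi)..Real.pi, saddleKernel (W n) θ).re) atTop (𝓝 √(2 * Real.pi)) := by
    exact (Complex.continuous_re.tendsto _).comp
      (tendsto_saddleScale_mul_integral.comp hWtop)
  have hre' := (isEquivalent_const_iff_tendsto (by positivity : √(2 * Real.pi) ≠ 0)).2 hre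
  have hsqrt : (fun n => √(W n + 1)) ~[atTop] fun n => √(W n) := by
    refine (isEquivalent_iff_tendsto_one ?_).2 ?_
    · filter_upwards [hWtop.eventually_gt_atTop 0] with n hn
      positivity
    · have h1 : Tendsto (fun n => √(1 + (W n)⁻¹)) atTop (𝓝 1) := by
        simpa using (((tendsto_inv_atTop_zero.comp hWtop).const_add 1).sqrt)
      refine h1.congr' ?_
      filter_upwards [hWtop.eventually_gt_atTop 0] with n hn
      rw [Pi.div_apply, ← Real.sqrt_div (by positivity)]
      congr 1
      field_simp
  have hmain := (((Stirling.factorial_isEquivalent_stirling.mul hre').div hsqrt).mul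
    (IsEquivalent.refl (u := fun n : ℕ => (2 * Real.pi)⁻¹ * (W n ^ n)⁻¹ * √n *
      Real.exp (Real.exp (W n) - 1))))
  refine (hmain.congr_left ?_).congr_right ?_
  · filter_upwards [eventually_gt_atTop 0] with n hn
    have hn' : (0 : ℝ) < n := Nat.cast_pos.2 hn
    have hr := pos_of_mul_exp_pos (hW n) hn'
    rw [popularity_leftRight_eq_integral hr (hW n)]
    -- Here `r * exp r = n` is used; `hsqrt` then replaces `√(W n + 1)` by `√(W n)`, the source of
    -- the half power in the result.
    have hs : saddleScale (W n) = √n * √(W n + 1) := by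
      rw [saddleScale, ← Real.sqrt_mul hn'.le, ← hW n]
      ring_nf
    simp only [Pi.mul_apply, Pi.div_apply]
    generalize ((saddleScale (W n) : ℂ) * _).re = J
    have h1 : √(W n + 1) ≠ 0 := by positivity
    have h2 : √(n : ℝ) ≠ 0 := by positivity
    rw [hs]
    field_simp
    rw [Real.sq_sqrt hn'.le]
  · filter_upwards [eventually_gt_atTop 0] with n hn
    have hn' : (0 : ℝ) < n := Nat.cast_pos.2 hn
    have hr := pos_of_mul_exp_pos (hW n) hn'
    have he : Real.exp (W n) = n / W n := by
      rw [eq_div_iff hr.ne', ← hW n, mul_comm]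
    have hE : Real.exp ((n : ℝ) / W n - n - 1) =
        Real.exp (n / W n - 1) * (Real.exp 1 ^ n)⁻¹ := by
      rw [← Real.exp_nat_mul, ← Real.exp_neg, ← Real.exp_add]
      ring_nf
    have hP : ((n : ℝ) / W n) ^ ((n : ℝ) + 1 / 2) = (n ^ n / W n ^ n) * (√n / √(W n)) := by
      rw [Real.rpow_add (by positivity), Real.rpow_natCast, ← Real.sqrt_eq_rpow,
        Real.sqrt_div hn'.le, div_pow]
    have h2pi : √(2 * n * Real.pi) = √(2 * Real.pi) * √n := by
      rw [← Real.sqrt_mul (by positivity)]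
      ring_nf
    have hsq : √(2 * Real.pi) * √(2 * Real.pi) = 2 * Real.pi :=
      Real.mul_self_sqrt (by positivity)
    simp only [Pi.mul_apply, Pi.div_apply, Function.const_apply]
    rw [he, hE, hP, h2pi, div_pow]
    have h1 : √(W n) ≠ 0 := by positivity
    have h2 : √(n : ℝ) ≠ 0 := by positivity
    rw [show √(2 * Real.pi) * √n * (n ^ n / Real.exp 1 ^ n) * √(2 * Real.pi) =
      (√(2 * Real.pi) * √(2 * Real.pi)) * √n * (n ^ n / Real.exp 1 ^ n) by ring, hsq]
    field_simp

end Treeshelf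

theorem corollary3 :
    -- the exponential generating function of the popularity, as a formal power series
    (PowerSeries.mk (fun n : ℕ =>
        (Treeshelf.popularity Treeshelf.leftRight n : ℚ) / (n.factorial : ℚ)) =
      (PowerSeries.X * PowerSeries.exp ℚ - PowerSeries.exp ℚ + 1) *
        PowerSeries.subst (PowerSeries.exp ℚ - 1 : PowerSeries ℚ) (PowerSeries.exp ℚ)) ∧
    -- its coefficients in terms of the Bell numbers
    (∀ n : ℕ, (Treeshelf.popularity Treeshelf.leftRight n : ℤ) =
      ((n : ℤ) + 1) * (Nat.bell n : ℤ) - (Nat.bell (n + 1) : ℤ)) ∧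
    -- the values of the Lambert function, and the asymptotics
    (∀ n : ℕ, ∃! w : ℝ, w * Real.exp w = (n : ℝ)) ∧
    (∀ W : ℕ → ℝ, (∀ n : ℕ, W n * Real.exp (W n) = (n : ℝ)) →
      Asymptotics.IsEquivalent Filter.atTop
        (fun n : ℕ => (Treeshelf.popularity Treeshelf.leftRight n : ℝ))
        (fun n : ℕ => Real.sqrt (n : ℝ) * ((n : ℝ) / W n) ^ ((n : ℝ) + 1 / 2) *
          Real.exp ((n : ℝ) / W n - (n : ℝ) - 1))) := by
  exact ⟨Treeshelf.mk_popularity_leftRight, Treeshelf.popularity_leftRight,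
    fun n => existsUnique_mul_exp_eq n.cast_nonneg,
    fun _ hW => Treeshelf.isEquivalent_popularity_leftRight hW⟩
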